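/- Let $n\ge 0$ and let $D=(d_1,\dots,d_n)$ with $d_1\le\dots\le d_n$ be positive integers; put $M=\sum_i d_i$. Call $D$ a strict graphic sequence if $\sum_{i=n-k+1}^n d_i<k(k-1)+\sum_{i=1}^{n-k}\min\{k,d_i\}$ for all $1\le k\le n$, and, for $\varepsilon>0$, a strict graphic sequence of type $\varepsilon$ if moreover $M$ is even and $n^{1+\varepsilon}\le M$. Let $\mathbb G^D$ be the set of simple graphs on $\{1,\dots,n\}$ in which vertex $i$ has degree $d_i$ for every $i$. Let $\widetilde{\mathbf p}=(\widetilde p_{ij})$ be the point at which $H_1(x)=\sum_{i<j}\bigl(-x_{ij}\log x_{ij}-(1-x_{ij})\log(1-x_{ij})\bigr)$ attains its maximum over all symmetric $x=(x_{ij})_{i\ne j}$ with $0\le x_{ij}\le 1$ and $\sum_{j\ne i}x_{ij}=d_i$ for all $i$, and let $\widetilde{\mathcal G}(D)$ be the random graph on $\{1,\dots,n\}$ whose edges $\langle i,j\rangle$ are present independently with probabilities $\widetilde p_{ij}$. Let $\mathcal G_{\mathbf g}(D)$ be uniform on $\mathbb G^D$. For a tree $T$ on the vertex set $\{1,\dots,k\}$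 with degrees $b_u$ and an injection $s:\{1,\dots,k\}\to\{1,\dots,n\}$ let $\psi(s,T,D)=\prod_u d_{s(u)}^{\,b_u-1}$, and let $\mathbf p_{\mathbf g}(s,T)$ and $\widetilde{\mathbf p}(s,T)$ be the probabilities that $s$ maps every edge of $T$ to an edge of $\mathcal G_{\mathbf g}(D)$, respectively of $\widetilde{\mathcal G}(D)$. Put $$L_{\mathbf g}(k,D)=\frac1M\sum_{(s,T)}\frac1{\psi(s,T,D)}\bigl|\mathbf p_{\mathbf g}(s,T)-\widetilde{\mathbf p}(s,T)\bigr|,$$ the sum being over all such pairs $(s,T)$. Then: (1) If $D$ is a strict graphic sequence and $\mathbb G^D\neq\emptyset$, then $P(\widetilde{\mathcal G}(D)\in\mathbb G^D)>0$, and $\widetilde{\mathcal G}(D)$ conditioned on $\widetilde{\mathcal G}(D)\in\mathbb G^D$ is uniform on $\mathbb G^D$. (2) For every $k$ and every $\eta>0$ there is a constant $c>0$, depending only on $k$ and $\eta$, such that for every $\varepsilon>0$, every $n$ and every strict graphic sequence $D$ of type $\varepsilon$ and length $n$: if $P(\widetilde{\mathcal G}(D)\in\mathbb G^D)\ge e^{-\eta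 n\log n}$, then $$L_{\mathbf g}(k,D)\le c\,\sqrt{\frac{n\log n}{M}}.$$ (3) Consequently, for every $\varepsilon>0$: if there is $\eta>0$ such that $e^{-\eta n\log n}e^{H_1(\widetilde{\mathbf p})}\le|\mathbb G^D|\le e^{H_1(\widetilde{\mathbf p})}$ for all $n$ and all strict graphic sequences $D$ of type $\varepsilon$ and length $n$, then for every $k$ there is $c_k>0$ such that $L_{\mathbf g}(k,D)\le c_k\sqrt{n\log n/M}$ for all $n$ and all strict graphic sequences $D$ of type $\varepsilon$ and length $n$. -/

import Mathlib

noncomputable section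

open scoped Classical

namespace DegSeq

/-- `M = d₁ + ⋯ + dₙ`. -/
def total {n : ℕ} (D : Fin n → ℕ) : ℕ := ∑ i, D i

/-- The strict Erdős–Gallai conditions for a sequence `d₁ ≤ ⋯ ≤ dₙ` (indexed from `0` in `Fin n`): for `1 ≤ k ≤ n` the sum of the `k` largest degrees is less than
`k (k - 1)` plus the sum of `min k dᵢ` over the other indices. -/
def StrictErdosGallai {n : ℕ} (D : Fin n → ℕ) : Prop :=
  ∀ k : ℕ, 1 ≤ k → k ≤ n →
    ∑ i : Fin n with n - k ≤ i.val, D i <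
      k * (k - 1) + ∑ i : Fin n with i.val < n - k, min k (D i)

/-- Strict graphic sequences: nondecreasing, positive, strict Erdős–Gallai. -/
structure IsStrictGraphic {n : ℕ} (D : Fin n → ℕ) : Prop where
  mono : Monotone D
  pos : ∀ i, 0 < D i
  strictEG : StrictErdosGallai D

/-- Strict graphic sequences of type `ε`: moreover `M` is even and `n ^ (1 + ε) ≤ M`. -/
structure IsStrictGraphicOfType {n : ℕ} (ε : ℝ) (D : Fin n → ℕ) : Prop
    extends IsStrictGraphic D where
  even_total : Even (total D)
  le_total : (n : ℝ) ^ (1 + ε) ≤ (total D : ℝ)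

/-- The polytope of the `x = (x_{ij})_{i ≠ j}` with `x_{ij} = x_{ji} ∈ [0, 1]` and
`∑_{j ≠ i} x_{ij} = dᵢ`; the unused diagonal entries are set to `0`. -/
structure IsInPolytope {n : ℕ} (D : Fin n → ℕ) (x : Fin n → Fin n → ℝ) : Prop where
  symm : ∀ i j, x i j = x j i
  diag : ∀ i, x i i = 0
  nonneg : ∀ i j, 0 ≤ x i j
  le_one : ∀ i j, x i j ≤ 1
  row_sum : ∀ i, ∑ j, x i j = (D i : ℝ)

/-- `H₁(x) = ∑_{i < j} H(x_{ij})` with `H(t) = - t log t - (1 - t) log (1 - t)`. -/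
def entropy {n : ℕ} (x : Fin n → Fin n → ℝ) : ℝ :=
  ∑ e : Fin n × Fin n with e.1 < e.2, Real.binEntropy (x e.1 e.2)

/-- `p` is the point of the polytope at which the entropy takes its maximum. -/
def IsMaxEntropy {n : ℕ} (D : Fin n → ℕ) (p : Fin n → Fin n → ℝ) : Prop :=
  IsInPolytope D p ∧ ∀ x, IsInPolytope D x → entropy x ≤ entropy p

/-- The set of simple graphs on `n` labelled vertices in which vertex `i` has degree `dᵢ`. -/
def graphs {n : ℕ} (D : Fin n → ℕ) : Finset (SimpleGraph (Fin n)) :=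
  {G | ∀ i, G.degree i = D i}

/-- The probability that the random graph with independent edges, the edge `⟨i, j⟩` being present
with probability `p i j`, equals `G`. -/
def bernoulliMass {n : ℕ} (p : Fin n → Fin n → ℝ) (G : SimpleGraph (Fin n)) : ℝ :=
  ∏ e : Fin n × Fin n with e.1 < e.2, if G.Adj e.1 e.2 then p e.1 e.2 else 1 - p e.1 e.2

/-- The probability that the independent-edge random graph lies in `S`. -/
def bernoulliProb {n : ℕ} (p : Fin n → Fin n → ℝ) (S : Finset (SimpleGraph (Fin n))) : ℝ :=
  ∑ G ∈ S, bernoulliMass p G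

/-- The indicator `1_s(T, G)`: every edge of `T` is mapped by `s` to an edge of `G`. -/
def treeIndicator {k n : ℕ} (s : Fin k ↪ Fin n) (T : SimpleGraph (Fin k))
    (G : SimpleGraph (Fin n)) : ℝ :=
  if ∀ u v, T.Adj u v → G.Adj (s u) (s v) then 1 else 0

/-- The expectation of `1_s(T, ·)` for the independent-edge random graph. -/
def treeProbBernoulli {k n : ℕ} (p : Fin n → Fin n → ℝ) (s : Fin k ↪ Fin n)
    (T : SimpleGraph (Fin k)) : ℝ :=
  ∑ G : SimpleGraph (Fin n), bernoulliMass p G * treeIndicator s T G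

/-- The expectation of `1_s(T, ·)` for the uniform random graph with degree sequence `D`. -/
def treeProbUniform {k n : ℕ} (D : Fin n → ℕ) (s : Fin k ↪ Fin n)
    (T : SimpleGraph (Fin k)) : ℝ :=
  (∑ G ∈ graphs D, treeIndicator s T G) / ((graphs D).card : ℝ)

/-- The `B`-function `∏_u d_{s(u)} ^ (b_u - 1)`, where `b_u` is the degree of `u` in `T`. -/
def bFunction {k n : ℕ} (D : Fin n → ℕ) (s : Fin k ↪ Fin n) (T : SimpleGraph (Fin k)) : ℝ :=
  ∏ u, (D (s u) : ℝ) ^ ((T.degree u : ℤ) - 1)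

/-- The discrepancy `L_g(k, D)`, a sum over all pairs of an injection `s : [k] → [n]` and a tree
`T` on the vertex set `[k]`. -/
def discrepancy {n : ℕ} (k : ℕ) (D : Fin n → ℕ) (p : Fin n → Fin n → ℝ) : ℝ :=
  1 / (total D : ℝ) *
    ∑ s : Fin k ↪ Fin n, ∑ T : SimpleGraph (Fin k) with T.IsTree,
      1 / bFunction D s T * |treeProbUniform D s T - treeProbBernoulli p s T|

/-- The conjectured two-sided bound on the number of graphs with degree sequence `D`, for
sequences of type `ε`. -/
def LowerBoundConjecture (ε : ℝ) : Prop :=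
  ∃ η : ℝ, 0 < η ∧ ∀ (n : ℕ) (D : Fin n → ℕ) (p : Fin n → Fin n → ℝ),
    IsStrictGraphicOfType ε D → IsMaxEntropy D p →
      Real.exp (-η * n * Real.log n) * Real.exp (entropy p) ≤ ((graphs D).card : ℝ) ∧
        ((graphs D).card : ℝ) ≤ Real.exp (entropy p)

/-- The conjectured bound on the discrepancy, for sequences of type `ε`. -/
def DiscrepancyConjecture (ε : ℝ) : Prop :=
  ∀ k : ℕ, ∃ c : ℝ, 0 < c ∧ ∀ (n : ℕ) (D : Fin n → ℕ) (p : Fin n → Fin n → ℝ),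
    IsStrictGraphicOfType ε D → IsMaxEntropy D p →
      discrepancy k D p ≤ c * Real.sqrt (n * Real.log n / total D)

end DegSeq

end

/-!
The adjacency matrix of every graph with degree sequence `D` lies in the polytope, so the
first-order condition at the maximum-entropy point `p`, in the direction of that matrix, shows that
the random graph with independent edges gives each such graph the same mass `exp (-H₁(p))`:
conditioned on its degrees it is uniform. Passing from the independent model to the uniform one
therefore costs a factor `1 / P`, where `P ≥ exp (-η n log n)` is the probability of the degree
sequence, hence an additive `η n log n` in an exponential-moment (Chernoff) bound.

For the discrepancy, prune the tree one leaf `ℓ` at a time. In the uniform model the copies of the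
pruned tree rooted at a vertex `v`, weighted by `1 / ψ`, number at most `d_v`, so the error made in
replacing the leaf edge by its probability is a sum over `v` of at most unit weights times
`∑_w ± (A_{vw} - p_{vw})`. Optimising the exponent `l` in `n log n / l + l M` gives
`√(M n log n)`.
-/

namespace DegSeq

noncomputable section

open scoped Classical BigOperators Topology
open Filter

/-! ### The maximum-entropy point -/

lemma eventually_mul_lt_binEntropy (C : ℝ) :
    ∀ᶠ s in 𝓝[>] (0 : ℝ), C * s < Real.binEntropy s := by
  filter_upwards [Real.tendsto_log_nhdsGT_zero.eventually_lt_atBot (-C),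
    Ioo_mem_nhdsGT one_pos] with s hlog hs
  have hnonneg := Real.negMulLog_nonneg (sub_nonneg.2 hs.2.le) (sub_le_self 1 hs.1.le)
  rw [Real.binEntropy_eq_negMulLog_add_negMulLog_one_sub, Real.negMulLog]
  nlinarith [hs.1]

lemma add_mul_sub_mem_Icc {a b t : ℝ} (ha : a ∈ Set.Icc (0 : ℝ) 1) (hb : b ∈ Set.Icc (0 : ℝ) 1)
    (ht : t ∈ Set.Icc (0 : ℝ) 1) : a + t * (b - a) ∈ Set.Icc (0 : ℝ) 1 :=
  (convex_Icc 0 1).add_smul_sub_mem ha hb ht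

lemma one_sub_mul_binEntropy_le {a b t : ℝ} (ha : a ∈ Set.Icc (0 : ℝ) 1)
    (hb : b ∈ Set.Icc (0 : ℝ) 1) (ht : t ∈ Set.Icc (0 : ℝ) 1) :
    (1 - t) * Real.binEntropy a ≤ Real.binEntropy (a + t * (b - a)) := by
  have hconcave := Real.strictConcave_binEntropy.concaveOn.2 ha hb (sub_nonneg.2 ht.2) ht.1
    (sub_add_cancel 1 t)
  have hnonneg := mul_nonneg ht.1 (Real.binEntropy_nonneg hb.1 hb.2)
  rw [smul_eq_mul, smul_eq_mul, smul_eq_mul, smul_eq_mul] at hconcave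
  rw [show a + t * (b - a) = (1 - t) * a + t * b by ring]
  linarith

lemma binEntropy_add_mul_sub_of_eq_zero_or_eq_one {a b : ℝ} (ha : a = 0 ∨ a = 1)
    (hb : b ∈ Set.Icc (0 : ℝ) 1) (t : ℝ) :
    Real.binEntropy (a + t * (b - a)) = Real.binEntropy (|b - a| * t) := by
  rcases ha with rfl | rfl
  · rw [sub_zero, abs_of_nonneg hb.1, zero_add, mul_comm]
  · rw [abs_of_nonpos (sub_nonpos.2 hb.2), ← Real.binEntropy_one_sub]
    congr 1
    ring

variable {n : ℕ} {D : Fin n → ℕ} {p x y : Fin n → Fin n → ℝ}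

lemma IsInPolytope.mem_Icc (hx : IsInPolytope D x) (i j : Fin n) : x i j ∈ Set.Icc (0 : ℝ) 1 :=
  ⟨hx.nonneg i j, hx.le_one i j⟩

lemma IsInPolytope.add_mul_sub (hx : IsInPolytope D x) (hy : IsInPolytope D y) {t : ℝ}
    (h : ∀ i j, x i j + t * (y i j - x i j) ∈ Set.Icc (0 : ℝ) 1) :
    IsInPolytope D fun i j => x i j + t * (y i j - x i j) where
  symm i j := by rw [hx.symm, hy.symm]
  diag i := by simp [hx.diag, hy.diag]
  nonneg i j := (h i j).1
  le_one i j := (h i j).2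
  row_sum i := by
    simp [Finset.sum_add_distrib, ← Finset.mul_sum, hx.row_sum, hy.row_sum]

/-- The infinite slope of the entropy at `0` and `1` pays for any move off the boundary. -/
lemma IsMaxEntropy.eq_of_eq_zero_or_eq_one (hp : IsMaxEntropy D p) (hx : IsInPolytope D x)
    {i j : Fin n} (hpij : p i j = 0 ∨ p i j = 1) : x i j = p i j := by
  wlog hij : i < j generalizing i j
  · rcases (not_lt.1 hij).eq_or_lt with rfl | hji
    · rw [hx.diag, hp.1.diag]
    · rw [hx.symm, hp.1.symm, this (by rwa [hp.1.symm]) hji]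
  by_contra hne
  set d := |x i j - p i j| with hd_def
  have hd : 0 < d := abs_pos.2 (sub_ne_zero.2 hne)
  obtain ⟨t, hslope, ht0, ht1⟩ := ((eventually_nhdsGT_zero_mul_left hd
    (eventually_mul_lt_binEntropy (entropy p / d))).and (Ioo_mem_nhdsGT one_pos)).exists
  have ht : t ∈ Set.Icc (0 : ℝ) 1 := ⟨ht0.le, ht1.le⟩
  have hmax := hp.2 _ (hp.1.add_mul_sub hx fun a b =>
    add_mul_sub_mem_Icc (hp.1.mem_Icc a b) (hx.mem_Icc a b) ht)
  have hedge : ∀ e : Fin n × Fin n,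
      (1 - t) * Real.binEntropy (p e.1 e.2) +
          (if e = (i, j) then Real.binEntropy (d * t) else 0) ≤
        Real.binEntropy (p e.1 e.2 + t * (x e.1 e.2 - p e.1 e.2)) := fun e => by
    split_ifs with he
    · subst he
      rw [binEntropy_add_mul_sub_of_eq_zero_or_eq_one hpij (hx.mem_Icc i j) t]
      rcases hpij with h | h <;> simp [h, hd_def]
    · simpa using one_sub_mul_binEntropy_le (hp.1.mem_Icc _ _) (hx.mem_Icc _ _) ht
  have hgain : (1 - t) * entropy p + Real.binEntropy (d * t) ≤ entropy p := by
    refine le_trans ?_ hmax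
    simpa [entropy, Finset.sum_add_distrib, Finset.mul_sum, Finset.sum_ite_eq', hij] using
      Finset.sum_le_sum fun e (_ : e ∈ Finset.univ.filter fun e : Fin n × Fin n => e.1 < e.2) =>
        hedge e
  rw [← mul_assoc, div_mul_cancel₀ _ hd.ne'] at hslope
  linarith

lemma IsMaxEntropy.eventually_isInPolytope (hp : IsMaxEntropy D p) (hx : IsInPolytope D x) :
    ∀ᶠ t in 𝓝 (0 : ℝ), IsInPolytope D fun i j => p i j + t * (x i j - p i j) := by
  have hmem : ∀ i j, ∀ᶠ t in 𝓝 (0 : ℝ), p i j + t * (x i j - p i j) ∈ Set.Icc (0 : ℝ) 1 :=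
    fun i j => by
      by_cases hpij : p i j = 0 ∨ p i j = 1
      · simpa [hp.eq_of_eq_zero_or_eq_one hx hpij] using hp.1.mem_Icc i j
      · rw [not_or] at hpij
        have hcont : ContinuousAt (fun t : ℝ => p i j + t * (x i j - p i j)) 0 := by fun_prop
        exact hcont.eventually_mem (by
          simpa using Icc_mem_nhds ((hp.1.nonneg i j).lt_of_ne' hpij.1)
            ((hp.1.le_one i j).lt_of_ne hpij.2))
  filter_upwards [eventually_all.2 fun i => eventually_all.2 (hmem i)] with t ht
  exact hp.1.add_mul_sub hx ht

lemma IsMaxEntropy.sum_log_sub_log_mul_sub_eq_zero (hp : IsMaxEntropy D p)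
    (hx : IsInPolytope D x) :
    ∑ e : Fin n × Fin n with e.1 < e.2,
      (Real.log (1 - p e.1 e.2) - Real.log (p e.1 e.2)) * (x e.1 e.2 - p e.1 e.2) = 0 := by
  have hmax : IsLocalMax (fun t : ℝ => entropy fun i j => p i j + t * (x i j - p i j)) 0 := by
    filter_upwards [hp.eventually_isInPolytope hx] with t ht
    simpa using hp.2 _ ht
  refine hmax.hasDerivAt_eq_zero (HasDerivAt.fun_sum fun e _ => ?_)
  by_cases hpe : p e.1 e.2 = 0 ∨ p e.1 e.2 = 1
  · simpa [hp.eq_of_eq_zero_or_eq_one hx hpe] using hasDerivAt_const (0 : ℝ) _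
  · rw [not_or] at hpe
    have hline : HasDerivAt (fun t : ℝ => p e.1 e.2 + t * (x e.1 e.2 - p e.1 e.2))
        (x e.1 e.2 - p e.1 e.2) 0 := by
      simpa using ((hasDerivAt_id (0 : ℝ)).mul_const _).const_add (p e.1 e.2)
    exact HasDerivAt.comp (0 : ℝ) (by simpa using Real.hasDerivAt_binEntropy hpe.1 hpe.2) hline

lemma mem_graphs {G : SimpleGraph (Fin n)} : G ∈ graphs D ↔ ∀ i, G.degree i = D i := by
  simp only [graphs, Finset.mem_filter_univ]

lemma sum_adjMatrix_eq_degree {V : Type*} [Fintype V] (G : SimpleGraph V) (v : V) :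
    ∑ w, G.adjMatrix ℝ v w = G.degree v := by
  exact (G.degree_eq_sum_if_adj v).symm

lemma isInPolytope_adjMatrix {G : SimpleGraph (Fin n)} (hG : G ∈ graphs D) :
    IsInPolytope D (G.adjMatrix ℝ) where
  symm i j := by simp only [SimpleGraph.adjMatrix_apply, G.adj_comm]
  diag i := by simp
  nonneg i j := by rw [SimpleGraph.adjMatrix_apply]; split_ifs <;> norm_num
  le_one i j := by rw [SimpleGraph.adjMatrix_apply]; split_ifs <;> norm_num
  row_sum i := by rw [sum_adjMatrix_eq_degree, mem_graphs.1 hG]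

/-- By the first-order condition in the direction of `G`, whose adjacency matrix lies in the
polytope, the log-likelihood of `G` does not depend on `G`. -/
lemma IsMaxEntropy.bernoulliMass_eq (hp : IsMaxEntropy D p) {G : SimpleGraph (Fin n)}
    (hG : G ∈ graphs D) : bernoulliMass p G = Real.exp (-entropy p) := by
  have hA := isInPolytope_adjMatrix hG
  rw [bernoulliMass, entropy, ← sub_zero (-_), ← hp.sum_log_sub_log_mul_sub_eq_zero hA,
    ← Finset.sum_neg_distrib, ← Finset.sum_sub_distrib, Real.exp_sum]
  refine Finset.prod_congr rfl fun e _ => ?_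
  have heq := @IsMaxEntropy.eq_of_eq_zero_or_eq_one n D p _ hp hA e.1 e.2
  rw [SimpleGraph.adjMatrix_apply] at heq ⊢
  by_cases hpe : p e.1 e.2 = 0 ∨ p e.1 e.2 = 1
  · rw [heq hpe, sub_self, mul_zero]
    rcases hpe with h | h <;> rw [h] at heq <;> simp_all
  · rw [not_or] at hpe
    have h0 : 0 < p e.1 e.2 := (hp.1.nonneg _ _).lt_of_ne' hpe.1
    have h1 : 0 < 1 - p e.1 e.2 := sub_pos.2 ((hp.1.le_one _ _).lt_of_ne hpe.2)
    rw [Real.binEntropy_eq_negMulLog_add_negMulLog_one_sub, Real.negMulLog, Real.negMulLog]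
    split_ifs
    · rw [← Real.log_injOn_pos.eq_iff h0 (Real.exp_pos _), Real.log_exp]
      ring
    · rw [← Real.log_injOn_pos.eq_iff h1 (Real.exp_pos _), Real.log_exp]
      ring

lemma IsMaxEntropy.bernoulliProb_graphs (hp : IsMaxEntropy D p) :
    bernoulliProb p (graphs D) = (graphs D).card * Real.exp (-entropy p) := by
  rw [bernoulliProb, Finset.sum_congr rfl fun G hG => hp.bernoulliMass_eq hG, Finset.sum_const,
    nsmul_eq_mul]

lemma IsMaxEntropy.bernoulliProb_graphs_pos (hp : IsMaxEntropy D p) (h : (graphs D).Nonempty) :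
    0 < bernoulliProb p (graphs D) := by
  rw [hp.bernoulliProb_graphs]
  exact mul_pos (Nat.cast_pos.2 h.card_pos) (Real.exp_pos _)

lemma IsMaxEntropy.bernoulliMass_div_bernoulliProb (hp : IsMaxEntropy D p)
    {G : SimpleGraph (Fin n)} (hG : G ∈ graphs D) :
    bernoulliMass p G / bernoulliProb p (graphs D) = 1 / (graphs D).card := by
  rw [hp.bernoulliMass_eq hG, hp.bernoulliProb_graphs, mul_comm, ← div_div,
    div_self (Real.exp_ne_zero _)]

/-! ### Expectations over independent edges -/

lemma sum_prod_ite_adj {V R : Type*} [Fintype V] [LinearOrder V] [CommSemiring R]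
    (f g : V × V → R) :
    ∑ G : SimpleGraph V, ∏ e : V × V with e.1 < e.2, (if G.Adj e.1 e.2 then f e else g e) =
      ∏ e : V × V with e.1 < e.2, (f e + g e) := by
  set S : Finset (V × V) := {e | e.1 < e.2} with hS
  rw [Finset.prod_add]
  refine Finset.sum_bij' (fun G _ => S.filter fun e => G.Adj e.1 e.2)
    (fun t _ => SimpleGraph.fromRel fun i j => (i, j) ∈ t)
    (fun G _ => Finset.mem_powerset.2 (Finset.filter_subset _ _))
    (fun t _ => Finset.mem_univ _) (fun G _ => ?_) (fun t ht => ?_) fun G _ => ?_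
  · ext i j
    simp only [SimpleGraph.fromRel_adj, hS, Finset.mem_filter, Finset.mem_univ, true_and,
      G.adj_comm j i, ← or_and_right]
    exact ⟨fun h => h.2.2, fun h => ⟨h.ne, h.ne.lt_or_gt, h⟩⟩
  · have hlt : ∀ i j, (i, j) ∈ t → i < j := fun i j h =>
      (Finset.mem_filter.1 (Finset.mem_powerset.1 ht h)).2
    ext ⟨i, j⟩
    simp only [hS, Finset.mem_filter, Finset.mem_univ, true_and, SimpleGraph.fromRel_adj]
    exact ⟨fun ⟨hij, _, h⟩ => h.resolve_right fun h' => (hlt j i h').not_gt hij,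
      fun h => ⟨hlt i j h, (hlt i j h).ne, .inl h⟩⟩
  · rw [Finset.prod_ite, Finset.filter_not]

lemma sum_sum_eq_sum_lt {V R : Type*} [Fintype V] [LinearOrder V] [AddCommMonoid R]
    {f : V → V → R} (hf : ∀ i, f i i = 0) :
    ∑ i, ∑ j, f i j = ∑ e : V × V with e.1 < e.2, (f e.1 e.2 + f e.2 e.1) := by
  have hswap : ∑ e : V × V with e.1 < e.2, f e.2 e.1 = ∑ e : V × V with e.2 < e.1, f e.1 e.2 :=
    Finset.sum_equiv (Equiv.prodComm V V) (by simp) (by simp)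
  rw [Finset.sum_add_distrib, hswap, ← Finset.sum_union, ← Fintype.sum_prod_type']
  · refine (Finset.sum_subset (Finset.subset_univ _) fun e _ he => ?_).symm
    simp only [Finset.mem_union, Finset.mem_filter_univ, ← ne_iff_lt_or_gt, not_not] at he
    rw [he, hf]
  · exact Finset.disjoint_filter.2 fun e _ h => h.not_gt

lemma bernoulliMass_nonneg (h0 : ∀ i j, 0 ≤ p i j) (h1 : ∀ i j, p i j ≤ 1)
    (G : SimpleGraph (Fin n)) : 0 ≤ bernoulliMass p G := by
  refine Finset.prod_nonneg fun e _ => ?_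
  split_ifs
  exacts [h0 _ _, sub_nonneg.2 (h1 _ _)]

/-- The indicator of the event that the graph `G` contains the graph `H`. -/
def containment {V : Type*} (H G : SimpleGraph V) : ℝ := if H ≤ G then 1 else 0

/-- The probability that the random graph with independent edges of probabilities `p i j` contains
the graph `H`. -/
def containmentProb (p : Fin n → Fin n → ℝ) (H : SimpleGraph (Fin n)) : ℝ :=
  ∑ G, bernoulliMass p G * containment H G

lemma containmentProb_eq_prod (p : Fin n → Fin n → ℝ) (H : SimpleGraph (Fin n)) :
    containmentProb p H =
      ∏ e : Fin n × Fin n with e.1 < e.2, if H.Adj e.1 e.2 then p e.1 e.2 else 1 := by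
  have hterm : ∀ G : SimpleGraph (Fin n), bernoulliMass p G * containment H G =
      ∏ e : Fin n × Fin n with e.1 < e.2, if G.Adj e.1 e.2 then p e.1 e.2
        else if H.Adj e.1 e.2 then 0 else 1 - p e.1 e.2 := fun G => by
    by_cases hHG : H ≤ G
    · rw [containment, if_pos hHG, mul_one]
      refine Finset.prod_congr rfl fun e _ => ?_
      by_cases hG : G.Adj e.1 e.2
      · rw [if_pos hG, if_pos hG]
      · rw [if_neg hG, if_neg hG, if_neg fun hH => hG (hHG hH)]
    · rw [containment, if_neg hHG, mul_zero, eq_comm, Finset.prod_eq_zero_iff]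
      simp only [SimpleGraph.le_iff_adj, not_forall] at hHG
      obtain ⟨i, j, hH, hG⟩ := hHG
      rcases hH.ne.lt_or_gt with hij | hij
      · exact ⟨(i, j), by simpa using hij, by rw [if_neg hG, if_pos hH]⟩
      · exact ⟨(j, i), by simpa using hij, by
          rw [if_neg fun h => hG h.symm, if_pos hH.symm]⟩
  rw [containmentProb, Finset.sum_congr rfl fun G _ => hterm G,
    sum_prod_ite_adj (fun e => p e.1 e.2) fun e => if H.Adj e.1 e.2 then 0 else 1 - p e.1 e.2]
  refine Finset.prod_congr rfl fun e _ => ?_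
  split_ifs <;> ring

lemma containment_sup_edge {V : Type*} {H G : SimpleGraph V} {a b : V} (hab : a ≠ b) :
    containment (H ⊔ SimpleGraph.edge a b) G = containment H G * G.adjMatrix ℝ a b := by
  simp only [containment, SimpleGraph.adjMatrix_apply, sup_le_iff, SimpleGraph.edge_le_iff, hab,
    false_or, ite_and, mul_ite, mul_one, mul_zero]
  split_ifs <;> rfl

lemma containmentProb_sup_edge (hsymm : ∀ i j, p i j = p j i) {H : SimpleGraph (Fin n)}
    {a b : Fin n} (hab : a ≠ b) (hH : ¬ H.Adj a b) :
    containmentProb p (H ⊔ SimpleGraph.edge a b) = containmentProb p H * p a b := by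
  wlog hlt : a < b generalizing a b
  · rw [SimpleGraph.edge_comm, hsymm]
    exact this hab.symm (fun h => hH h.symm) (hab.lt_or_gt.resolve_left hlt)
  rw [containmentProb_eq_prod, containmentProb_eq_prod]
  trans ∏ e : Fin n × Fin n with e.1 < e.2,
    (if H.Adj e.1 e.2 then p e.1 e.2 else 1) * if e = (a, b) then p a b else 1
  · refine Finset.prod_congr rfl fun ⟨i, j⟩ he => ?_
    have hij : i < j := (Finset.mem_filter.1 he).2
    simp only [SimpleGraph.sup_adj, SimpleGraph.edge_adj, Prod.mk.injEq]
    by_cases heq : i = a ∧ j = b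
    · obtain ⟨rfl, rfl⟩ := heq
      simp [hH, hab]
    · have hswap : ¬ (i = b ∧ j = a) := fun ⟨hi, hj⟩ => (hi ▸ hj ▸ hij).not_gt hlt
      simp [heq, hswap]
  · rw [Finset.prod_mul_distrib, Finset.prod_ite_eq', if_pos (by simpa using hlt)]

/-! ### Exponential moments -/

lemma exp_le_one_add_add_sq {y : ℝ} (hy : |y| ≤ 1) : Real.exp y ≤ 1 + y + y ^ 2 := by
  linarith [(abs_le.1 (Real.abs_exp_sub_one_sub_id_le hy)).2]

lemma bernoulli_mgf_le {q y : ℝ} (hq : q ∈ Set.Icc (0 : ℝ) 1) (hy : |y| ≤ 1) :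
    q * Real.exp (y * (1 - q)) + (1 - q) * Real.exp (y * (0 - q)) ≤ Real.exp (y ^ 2 * q) := by
  have hbound : ∀ r : ℝ, |r| ≤ 1 → Real.exp (y * r) ≤ 1 + y * r + (y * r) ^ 2 := fun r hr =>
    exp_le_one_add_add_sq (by rw [abs_mul]; exact mul_le_one₀ hy (abs_nonneg r) hr)
  have hpresent := mul_le_mul_of_nonneg_left
    (hbound (1 - q) (abs_le.2 ⟨by linarith [hq.2], by linarith [hq.1]⟩)) hq.1
  have habsent := mul_le_mul_of_nonneg_left
    (hbound (0 - q) (abs_le.2 ⟨by linarith [hq.2], by linarith [hq.1]⟩)) (sub_nonneg.2 hq.2)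
  nlinarith [Real.add_one_le_exp (y ^ 2 * q), sq_nonneg (y * q)]

lemma IsInPolytope.sum_lt_eq (hx : IsInPolytope D x) :
    2 * ∑ e : Fin n × Fin n with e.1 < e.2, x e.1 e.2 = total D := by
  have h := sum_sum_eq_sum_lt hx.diag
  simp only [hx.row_sum, hx.symm _ (Prod.fst _), ← two_mul] at h
  rw [total, Nat.cast_sum, h, Finset.mul_sum]

lemma bernoulliMass_mul_exp_eq (hp : IsInPolytope D p) (b : Fin n → Fin n → ℝ)
    (G : SimpleGraph (Fin n)) :
    bernoulliMass p G * Real.exp (∑ i, ∑ j, b i j * (G.adjMatrix ℝ i j - p i j)) =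
      ∏ e : Fin n × Fin n with e.1 < e.2,
        if G.Adj e.1 e.2 then p e.1 e.2 * Real.exp ((b e.1 e.2 + b e.2 e.1) * (1 - p e.1 e.2))
        else (1 - p e.1 e.2) * Real.exp ((b e.1 e.2 + b e.2 e.1) * (0 - p e.1 e.2)) := by
  rw [sum_sum_eq_sum_lt fun i => by simp [hp.diag], Real.exp_sum, bernoulliMass,
    ← Finset.prod_mul_distrib]
  refine Finset.prod_congr rfl fun e _ => ?_
  rw [SimpleGraph.adjMatrix_apply, SimpleGraph.adjMatrix_apply, G.adj_comm e.2 e.1,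
    hp.symm e.2 e.1, ← add_mul]
  split_ifs <;> rfl

lemma IsInPolytope.sum_bernoulliMass_mul_exp_le (hp : IsInPolytope D p) {b : Fin n → Fin n → ℝ}
    {l : ℝ} (hb : ∀ i j, |b i j| ≤ l) (hl : l ≤ 1 / 2) :
    ∑ G : SimpleGraph (Fin n), bernoulliMass p G *
        Real.exp (∑ i, ∑ j, b i j * (G.adjMatrix ℝ i j - p i j)) ≤
      Real.exp (2 * l ^ 2 * total D) := by
  have hedge : ∀ e : Fin n × Fin n, |b e.1 e.2 + b e.2 e.1| ≤ 2 * l := fun e => by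
    linarith [abs_add_le (b e.1 e.2) (b e.2 e.1), hb e.1 e.2, hb e.2 e.1]
  simp only [bernoulliMass_mul_exp_eq hp]
  rw [sum_prod_ite_adj
    (fun e => p e.1 e.2 * Real.exp ((b e.1 e.2 + b e.2 e.1) * (1 - p e.1 e.2)))
    fun e => (1 - p e.1 e.2) * Real.exp ((b e.1 e.2 + b e.2 e.1) * (0 - p e.1 e.2))]
  calc _ ≤ ∏ e : Fin n × Fin n with e.1 < e.2, Real.exp (4 * l ^ 2 * p e.1 e.2) := by
        refine Finset.prod_le_prod (fun e _ => ?_) fun e _ => ?_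
        · exact add_nonneg (mul_nonneg (hp.nonneg _ _) (Real.exp_nonneg _))
            (mul_nonneg (sub_nonneg.2 (hp.le_one _ _)) (Real.exp_nonneg _))
        · refine (bernoulli_mgf_le (hp.mem_Icc _ _) ((hedge e).trans (by linarith))).trans
            (Real.exp_le_exp.2 (mul_le_mul_of_nonneg_right ?_ (hp.nonneg _ _)))
          linarith [sq_le_sq' (neg_le_of_abs_le (hedge e)) (le_of_abs_le (hedge e))]
    _ = Real.exp (2 * l ^ 2 * total D) := by
        rw [← Real.exp_sum, ← Finset.mul_sum, ← hp.sum_lt_eq]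
        ring_nf

lemma IsInPolytope.sum_bernoulliMass_mul_prod_sum_exp_le (hp : IsInPolytope D p) {J : Type*}
    [Fintype J] {b : Fin n → J → Fin n → ℝ} {l : ℝ} (hb : ∀ v i w, |b v i w| ≤ l)
    (hl : l ≤ 1 / 2) :
    ∑ G : SimpleGraph (Fin n), bernoulliMass p G *
        ∏ v, ∑ i, Real.exp (∑ w, b v i w * (G.adjMatrix ℝ v w - p v w)) ≤
      (Fintype.card J : ℝ) ^ n * Real.exp (2 * l ^ 2 * total D) := by
  simp only [Fintype.prod_sum, ← Real.exp_sum, Finset.mul_sum Finset.univ _ (bernoulliMass p _)]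
  rw [Finset.sum_comm]
  calc _ ≤ ∑ _σ : Fin n → J, Real.exp (2 * l ^ 2 * total D) :=
        Finset.sum_le_sum fun σ _ =>
          hp.sum_bernoulliMass_mul_exp_le (fun v w => hb v (σ v) w) hl
    _ = _ := by simp

/-! ### Comparison of the uniform graph with the independent-edge graph -/

lemma expect_log_le_log_expect {ι : Type*} {s : Finset ι} (hs : s.Nonempty) {X : ι → ℝ}
    (hX : ∀ i ∈ s, 0 < X i) : 𝔼 i ∈ s, Real.log (X i) ≤ Real.log (𝔼 i ∈ s, X i) := by
  have hcard : (s.card : ℝ) ≠ 0 := Nat.cast_ne_zero.2 hs.card_pos.ne'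
  have hjensen := strictConcaveOn_log_Ioi.concaveOn.le_map_sum (t := s) (p := X)
    (w := fun _ => (s.card : ℝ)⁻¹) (fun _ _ => by positivity)
    (by rw [Finset.sum_const, nsmul_eq_mul, mul_inv_cancel₀ hcard]) hX
  simpa only [Finset.expect_eq_sum_div_card, smul_eq_mul, inv_mul_eq_div, Finset.sum_div]
    using hjensen

lemma IsMaxEntropy.expect_graphs_le (hp : IsMaxEntropy D p) (hne : (graphs D).Nonempty)
    {X : SimpleGraph (Fin n) → ℝ} (hX : ∀ G, 0 ≤ X G) :
    𝔼 G ∈ graphs D, X G ≤ (∑ G, bernoulliMass p G * X G) / bernoulliProb p (graphs D) := by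
  have hcond : 𝔼 G ∈ graphs D, X G =
      (∑ G ∈ graphs D, bernoulliMass p G * X G) / bernoulliProb p (graphs D) := by
    rw [Finset.sum_congr rfl fun G hG => by rw [hp.bernoulliMass_eq hG], ← Finset.mul_sum,
      hp.bernoulliProb_graphs, mul_comm (Finset.card _ : ℝ),
      mul_div_mul_left _ _ (Real.exp_ne_zero _), Finset.expect_eq_sum_div_card]
  rw [hcond]
  refine div_le_div_of_nonneg_right (Finset.sum_le_sum_of_subset_of_nonneg
    (Finset.subset_univ _) fun G _ _ => ?_) (hp.bernoulliProb_graphs_pos hne).le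
  exact mul_nonneg (bernoulliMass_nonneg hp.1.nonneg hp.1.le_one G) (hX G)

lemma sum_mul_le_log_one_add_sum_exp {I : Type*} [Fintype I] {W z : I → ℝ} (hW : ∀ i, 0 ≤ W i)
    (hsum : ∑ i, W i ≤ 1) : ∑ i, W i * z i ≤ Real.log (1 + ∑ i, Real.exp (z i)) := by
  have hnonneg : 0 ≤ ∑ i, Real.exp (z i) := Finset.sum_nonneg fun i _ => Real.exp_nonneg _
  have hle : ∀ i, z i ≤ Real.log (1 + ∑ i, Real.exp (z i)) := fun i => by
    rw [Real.le_log_iff_exp_le (by linarith)]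
    linarith [Finset.single_le_sum (fun j _ => Real.exp_nonneg (z j)) (Finset.mem_univ i)]
  calc ∑ i, W i * z i ≤ ∑ i, W i * Real.log (1 + ∑ i, Real.exp (z i)) :=
        Finset.sum_le_sum fun i _ => mul_le_mul_of_nonneg_left (hle i) (hW i)
    _ ≤ Real.log (1 + ∑ i, Real.exp (z i)) := by
        rw [← Finset.sum_mul]
        exact mul_le_of_le_one_left (Real.log_nonneg (by linarith)) hsum

lemma IsMaxEntropy.expect_sum_mul_le (hp : IsMaxEntropy D p) (hne : (graphs D).Nonempty)
    {I : Type*} [Fintype I] {W : Fin n → I → SimpleGraph (Fin n) → ℝ}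
    (hW : ∀ v i, ∀ G, 0 ≤ W v i G) (hsum : ∀ v, ∀ G ∈ graphs D, ∑ i, W v i G ≤ 1)
    {b : Fin n → I → Fin n → ℝ} {l : ℝ} (hl0 : 0 ≤ l) (hl : l ≤ 1 / 2)
    (hb : ∀ v i w, |b v i w| ≤ l) :
    𝔼 G ∈ graphs D, ∑ v, ∑ i, W v i G * ∑ w, b v i w * (G.adjMatrix ℝ v w - p v w) ≤
      n * Real.log (Fintype.card I + 1) + 2 * l ^ 2 * total D -
        Real.log (bernoulliProb p (graphs D)) := by
  set Z : Fin n → I → SimpleGraph (Fin n) → ℝ :=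
    fun v i G => ∑ w, b v i w * (G.adjMatrix ℝ v w - p v w)
  set X : SimpleGraph (Fin n) → ℝ := fun G => ∏ v, (1 + ∑ i, Real.exp (Z v i G))
  have hpos : ∀ v G, 0 < 1 + ∑ i, Real.exp (Z v i G) := fun v G => by positivity
  have hmoment : ∑ G, bernoulliMass p G * X G ≤
      (Fintype.card I + 1 : ℝ) ^ n * Real.exp (2 * l ^ 2 * total D) := by
    have := hp.1.sum_bernoulliMass_mul_prod_sum_exp_le (J := Option I)
      (b := fun v o w => o.elim 0 fun i => b v i w)
      (fun v o w => by cases o <;> simp [hl0, hb]) hl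
    simpa [Fintype.sum_option, X, Z] using this
  have hP := hp.bernoulliProb_graphs_pos hne
  calc 𝔼 G ∈ graphs D, ∑ v, ∑ i, W v i G * Z v i G
      ≤ 𝔼 G ∈ graphs D, Real.log (X G) := Finset.expect_le_expect fun G hG => by
        rw [Real.log_prod fun v _ => (hpos v G).ne']
        exact Finset.sum_le_sum fun v _ =>
          sum_mul_le_log_one_add_sum_exp (fun i => hW v i G) (hsum v G hG)
    _ ≤ Real.log (𝔼 G ∈ graphs D, X G) :=
        expect_log_le_log_expect hne fun G _ => Finset.prod_pos fun v _ => hpos v G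
    _ ≤ Real.log ((Fintype.card I + 1 : ℝ) ^ n * Real.exp (2 * l ^ 2 * total D) /
          bernoulliProb p (graphs D)) := by
        refine Real.log_le_log (Finset.expect_pos (fun G _ => Finset.prod_pos fun v _ => hpos v G)
          hne) ((hp.expect_graphs_le hne fun G => (Finset.prod_pos fun v _ => hpos v G).le).trans
          (div_le_div_of_nonneg_right hmoment hP.le))
    _ = _ := by
        rw [Real.log_div (by positivity) hP.ne', Real.log_mul (by positivity)
          (Real.exp_ne_zero _), Real.log_pow, Real.log_exp]

/-- Absolute values are linearised by choosing a sign for each triple; the moment generating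
function of the signed sums bounds all sign choices at once. -/
lemma IsMaxEntropy.mul_sum_abs_expect_le (hp : IsMaxEntropy D p) (hne : (graphs D).Nonempty)
    {I : Type*} [Fintype I] {W : Fin n → I → SimpleGraph (Fin n) → ℝ}
    (hW : ∀ v i, ∀ G, 0 ≤ W v i G) (hsum : ∀ v, ∀ G ∈ graphs D, ∑ i, W v i G ≤ 1)
    {l : ℝ} (hl0 : 0 ≤ l) (hl : l ≤ 1 / 2) :
    l * ∑ v, ∑ i, ∑ w, |𝔼 G ∈ graphs D, W v i G * (G.adjMatrix ℝ v w - p v w)| ≤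
      n * Real.log (Fintype.card I + 1) + 2 * l ^ 2 * total D -
        Real.log (bernoulliProb p (graphs D)) := by
  set E : Fin n → I → Fin n → ℝ :=
    fun v i w => 𝔼 G ∈ graphs D, W v i G * (G.adjMatrix ℝ v w - p v w)
  set b : Fin n → I → Fin n → ℝ := fun v i w => l * SignType.sign (E v i w)
  have hb : ∀ v i w, |b v i w| ≤ l := fun v i w => by
    rw [abs_mul, abs_of_nonneg hl0]
    refine mul_le_of_le_one_right hl0 ?_
    rcases SignType.sign (E v i w) with _ | _ | _ <;> simp
  refine le_trans (le_of_eq ?_) (hp.expect_sum_mul_le hne hW hsum hl0 hl hb)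
  simp only [Finset.mul_sum, Finset.expect_sum_comm]
  refine Finset.sum_congr rfl fun v _ => Finset.sum_congr rfl fun i _ =>
    Finset.sum_congr rfl fun w _ => ?_
  rw [← sign_mul_self, ← mul_assoc, Finset.mul_expect]
  exact Finset.expect_congr rfl fun G _ => mul_left_comm _ _ _

lemma IsInPolytope.sum_abs_sub_le (hx : IsInPolytope D x) (hy : IsInPolytope D y) :
    ∑ v, ∑ w, |x v w - y v w| ≤ 2 * total D := by
  calc ∑ v, ∑ w, |x v w - y v w| ≤ ∑ v, ∑ w, (x v w + y v w) :=
        Finset.sum_le_sum fun v _ => Finset.sum_le_sum fun w _ =>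
          abs_sub_le_iff.2 ⟨by linarith [hy.nonneg v w], by linarith [hx.nonneg v w]⟩
    _ = 2 * total D := by
        simp only [Finset.sum_add_distrib, hx.row_sum, hy.row_sum, total, Nat.cast_sum]
        ring

lemma IsInPolytope.sum_abs_expect_le (hp : IsInPolytope D p) (hne : (graphs D).Nonempty)
    {I : Type*} [Fintype I] {W : Fin n → I → SimpleGraph (Fin n) → ℝ}
    (hW : ∀ v i, ∀ G, 0 ≤ W v i G) (hsum : ∀ v, ∀ G ∈ graphs D, ∑ i, W v i G ≤ 1) :
    ∑ v, ∑ i, ∑ w, |𝔼 G ∈ graphs D, W v i G * (G.adjMatrix ℝ v w - p v w)| ≤ 2 * total D := by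
  calc _ ≤ ∑ v, ∑ i, ∑ w, 𝔼 G ∈ graphs D, W v i G * |G.adjMatrix ℝ v w - p v w| := by
        gcongr with v _ i _ w _
        refine (Finset.abs_expect_le _ _).trans_eq (Finset.expect_congr rfl fun G _ => ?_)
        rw [abs_mul, abs_of_nonneg (hW v i G)]
    _ = 𝔼 G ∈ graphs D, ∑ v, (∑ i, W v i G) * ∑ w, |G.adjMatrix ℝ v w - p v w| := by
        simp only [← Finset.expect_sum_comm, Finset.sum_mul_sum]
    _ ≤ 2 * total D := Finset.expect_le hne fun G hG => by
        refine (Finset.sum_le_sum fun v _ => ?_).trans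
          ((isInPolytope_adjMatrix hG).sum_abs_sub_le hp)
        exact mul_le_of_le_one_left (Finset.sum_nonneg fun w _ => abs_nonneg _) (hsum v G hG)

lemma le_mul_sqrt_of_forall_mul_le {A L M x : ℝ} (hA : 0 ≤ A) (hL : 0 < L) (hM : 0 ≤ M)
    (hx : x ≤ 2 * M) (h : ∀ l, 0 ≤ l → l ≤ 1 / 2 → l * x ≤ A * L + 2 * l ^ 2 * M) :
    x ≤ (2 * A + 2) * √(M * L) := by
  have hsq : √(M * L) ^ 2 = M * L := Real.sq_sqrt (mul_nonneg hM hL.le)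
  rcases lt_or_ge M L with hML | hLM
  · have hMr : M ≤ √(M * L) := Real.le_sqrt_of_sq_le (by nlinarith)
    nlinarith [mul_nonneg hA (Real.sqrt_nonneg (M * L))]
  · have hMpos : 0 < M := hL.trans_le hLM
    have hrpos : 0 < √(M * L) := Real.sqrt_pos.2 (mul_pos hMpos hL)
    have hrM : √(M * L) ≤ M := Real.sqrt_le_iff.2 ⟨hM, by nlinarith⟩
    have hopt := h (√(M * L) / (2 * M)) (by positivity)
      (by rw [div_le_div_iff₀ (by positivity) two_pos]; linarith)
    rw [div_pow, hsq, div_mul_eq_mul_div, div_le_iff₀ (by positivity)] at hopt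
    have hscaled : √(M * L) * x ≤ √(M * L) * ((2 * A + 1) * √(M * L)) := by
      calc √(M * L) * x ≤ (A * L + 2 * (M * L / (2 * M) ^ 2) * M) * (2 * M) := hopt
        _ = (2 * A + 1) * √(M * L) ^ 2 := by rw [hsq]; field_simp
        _ = _ := by ring
    linarith [le_of_mul_le_mul_left hscaled hrpos]

lemma graphs_nonempty_of_bernoulliProb_pos (h : 0 < bernoulliProb p (graphs D)) :
    (graphs D).Nonempty := by
  by_contra hempty
  rw [Finset.not_nonempty_iff_eq_empty.1 hempty, bernoulliProb, Finset.sum_empty] at h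
  exact h.false

lemma IsMaxEntropy.sum_abs_expect_le_sqrt (hp : IsMaxEntropy D p) (hn : 2 ≤ n) {η : ℝ}
    (hη : 0 ≤ η) (hP : Real.exp (-η * n * Real.log n) ≤ bernoulliProb p (graphs D))
    {I : Type*} [Fintype I] {m : ℕ} (hI : Fintype.card I + 1 ≤ n ^ m)
    {W : Fin n → I → SimpleGraph (Fin n) → ℝ} (hW : ∀ v i, ∀ G, 0 ≤ W v i G)
    (hsum : ∀ v, ∀ G ∈ graphs D, ∑ i, W v i G ≤ 1) :
    ∑ v, ∑ i, ∑ w, |𝔼 G ∈ graphs D, W v i G * (G.adjMatrix ℝ v w - p v w)| ≤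
      (2 * (η + m) + 2) * √(total D * (n * Real.log n)) := by
  have hn' : (1 : ℝ) < n := by exact_mod_cast hn
  have hne := graphs_nonempty_of_bernoulliProb_pos ((Real.exp_pos _).trans_le hP)
  refine le_mul_sqrt_of_forall_mul_le (by positivity)
    (mul_pos (by linarith) (Real.log_pos hn')) (Nat.cast_nonneg _)
    (hp.1.sum_abs_expect_le hne hW hsum) fun l hl0 hl => ?_
  have hlogP : -η * n * Real.log n ≤ Real.log (bernoulliProb p (graphs D)) :=
    (Real.le_log_iff_exp_le ((Real.exp_pos _).trans_le hP)).2 hP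
  have hlogI : Real.log (Fintype.card I + 1) ≤ m * Real.log n := by
    rw [← Real.log_pow]
    exact Real.log_le_log (by positivity) (by exact_mod_cast hI)
  linarith [hp.mul_sum_abs_expect_le hne hW hsum hl0 hl,
    mul_le_mul_of_nonneg_left hlogI (Nat.cast_nonneg (α := ℝ) n)]

/-! ### Embedded trees -/

section Trees

variable {V α : Type*} {T : SimpleGraph V} {ℓ : V} {u : ({ℓ}ᶜ : Set V)}

/-- The vertex `ℓ` is a leaf of `T` with neighbour `u`. The neighbour is an element of the subtype
`{ℓ}ᶜ`, so that it is also a vertex of the pruned graph `T.induce {ℓ}ᶜ`. -/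
def IsLeafAt (T : SimpleGraph V) (ℓ : V) (u : ({ℓ}ᶜ : Set V)) : Prop := ∀ v, T.Adj ℓ v ↔ v = u

lemma exists_isLeafAt_of_isTree [Finite V] [Nontrivial V] (hT : T.IsTree) (x : V) :
    ∃ ℓ u, ℓ ≠ x ∧ IsLeafAt T ℓ u ∧ (T.induce {ℓ}ᶜ).IsTree := by
  have := Fintype.ofFinite V
  obtain ⟨ℓ, hℓx, hℓ⟩ : ∃ ℓ, ℓ ≠ x ∧ T.degree ℓ = 1 := by
    obtain ⟨a, b, hab, ha, hb⟩ := hT.exists_ne_and_degree_eq_one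
    rcases eq_or_ne a x with rfl | hax
    exacts [⟨b, hab.symm, hb⟩, ⟨a, hax, ha⟩]
  obtain ⟨u, hu, huniq⟩ := SimpleGraph.degree_eq_one_iff_existsUnique_adj.1 hℓ
  exact ⟨ℓ, ⟨u, hu.ne'⟩, hℓx, fun v => ⟨huniq v, fun h => h ▸ hu⟩,
    hT.connected.induce_compl_singleton_of_degree_eq_one hℓ, hT.isAcyclic.induce _⟩

lemma rootedTree_induction.{w} {motive : ∀ (V : Type w) [Fintype V], SimpleGraph V → V → Prop}
    (singleton : ∀ (V : Type w) [Fintype V] [Subsingleton V] (T : SimpleGraph V) (x : V),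
      motive V T x)
    (leaf : ∀ (V : Type w) [Fintype V] (T : SimpleGraph V) (ℓ : V) (u x : ({ℓ}ᶜ : Set V)),
      IsLeafAt T ℓ u → (T.induce {ℓ}ᶜ).IsTree → motive ({ℓ}ᶜ : Set V) (T.induce {ℓ}ᶜ) x →
        motive V T x)
    (V : Type w) [Fintype V] {T : SimpleGraph V} (hT : T.IsTree) (x : V) : motive V T x := by
  induction hcard : Fintype.card V using Nat.strong_induction_on generalizing V with
  | _ m ih =>
    cases subsingleton_or_nontrivial V
    · exact singleton V T x
    · obtain ⟨ℓ, u, hℓx, hℓ, hT'⟩ := exists_isLeafAt_of_isTree hT x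
      refine leaf V T ℓ u ⟨x, hℓx.symm⟩ hℓ hT' (ih _ ?_ _ hT' _ rfl)
      rw [← hcard]
      exact Fintype.card_subtype_lt (x := ℓ) fun h => h rfl

/-- The restriction of an embedding to the vertices other than `ℓ`. -/
def eraseVertex (ℓ : V) (s : V ↪ α) : ({ℓ}ᶜ : Set V) ↪ α :=
  (Function.Embedding.subtype _).trans s

lemma IsLeafAt.map_eq (hℓ : IsLeafAt T ℓ u) (s : V ↪ α) :
    T.map s = (T.induce {ℓ}ᶜ).map (eraseVertex ℓ s) ⊔ SimpleGraph.edge (s u) (s ℓ) := by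
  refine le_antisymm ?_ (sup_le ?_ ((SimpleGraph.edge_le_iff _).2 (.inr ?_)))
  · rw [SimpleGraph.map_le_iff_le_comap]
    intro a b hab
    by_cases ha : a = ℓ
    · subst ha
      rw [(hℓ b).1 hab]
      exact .inr (SimpleGraph.edge_adj _ _ _ _ |>.2
        ⟨.inr ⟨rfl, rfl⟩, fun h => u.2 (s.injective h).symm⟩)
    · by_cases hb : b = ℓ
      · subst hb
        rw [(hℓ a).1 hab.symm]
        exact .inr (SimpleGraph.edge_adj _ _ _ _ |>.2
          ⟨.inl ⟨rfl, rfl⟩, fun h => u.2 (s.injective h)⟩)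
      · exact .inl ((SimpleGraph.map_adj _ _ _ _).2 ⟨⟨a, ha⟩, ⟨b, hb⟩, hab, rfl, rfl⟩)
  · rw [SimpleGraph.map_le_iff_le_comap]
    exact fun a b hab => (SimpleGraph.map_adj _ _ _ _).2 ⟨a, b, hab, rfl, rfl⟩
  · exact (SimpleGraph.map_adj _ _ _ _).2 ⟨u, ℓ, ((hℓ u).2 rfl).symm, rfl, rfl⟩

lemma IsLeafAt.containment_map (hℓ : IsLeafAt T ℓ u) (s : V ↪ α) (G : SimpleGraph α) :
    containment (T.map s) G =
      containment ((T.induce {ℓ}ᶜ).map (eraseVertex ℓ s)) G * G.adjMatrix ℝ (s u) (s ℓ) := by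
  rw [hℓ.map_eq, containment_sup_edge (s.injective.ne u.2)]

lemma IsLeafAt.containmentProb_map (hℓ : IsLeafAt T ℓ u) (hsymm : ∀ i j, p i j = p j i)
    (s : V ↪ Fin n) : containmentProb p (T.map s) =
      containmentProb p ((T.induce {ℓ}ᶜ).map (eraseVertex ℓ s)) * p (s u) (s ℓ) := by
  rw [hℓ.map_eq, containmentProb_sup_edge hsymm (s.injective.ne u.2)]
  intro h
  obtain ⟨a, b, -, -, hb⟩ := (SimpleGraph.map_adj _ _ _ _).1 h
  exact b.2 (s.injective hb)

variable [Fintype V]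

@[to_additive]
lemma prod_eq_mul_prod_compl_singleton {M : Type*} [CommMonoid M] (a : V) (f : V → M) :
    ∏ v, f v = f a * ∏ v : ({a}ᶜ : Set V), f v := by
  rw [Fintype.prod_eq_mul_prod_compl a f,
    Finset.prod_subtype _ (p := (· ∈ ({a}ᶜ : Set V))) (by simp)]

lemma IsLeafAt.degree_eq_one (hℓ : IsLeafAt T ℓ u) : T.degree ℓ = 1 :=
  SimpleGraph.degree_eq_one_iff_existsUnique_adj.2 ⟨u, (hℓ u).2 rfl, fun v => (hℓ v).1⟩

lemma IsLeafAt.degree_coe (hℓ : IsLeafAt T ℓ u) (x : ({ℓ}ᶜ : Set V)) :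
    T.degree x = (T.induce {ℓ}ᶜ).degree x + if x = u then 1 else 0 := by
  have hdegree : ∀ {W : Type _} [Fintype W] (H : SimpleGraph W) (w : W)
      [Fintype (H.neighborSet w)], H.degree w = ∑ v, if H.Adj w v then 1 else 0 :=
    fun H w _ => by
      rw [Finset.sum_boole, Nat.cast_id, ← H.card_neighborFinset_eq_degree]
      exact congrArg Finset.card (by ext v; simp)
  rw [hdegree, hdegree, sum_eq_add_sum_compl_singleton ℓ, add_comm]
  simp only [T.adj_comm _ ℓ, hℓ _, Subtype.ext_iff, SimpleGraph.comap_adj,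
    Function.Embedding.subtype_apply]

/-- The reciprocal `∏_u d_{s(u)} ^ (1 - b_u)` of the `B`-function, for a graph on an arbitrary
vertex type. -/
def treeWeight (D : α → ℕ) (s : V ↪ α) (T : SimpleGraph V) : ℝ :=
  ∏ v, (D (s v) : ℝ) ^ (1 - (T.degree v : ℤ))

lemma treeWeight_nonneg (D : α → ℕ) (s : V ↪ α) (T : SimpleGraph V) : 0 ≤ treeWeight D s T :=
  Finset.prod_nonneg fun _ _ => zpow_nonneg (Nat.cast_nonneg _) _

lemma IsLeafAt.treeWeight_eq {D : α → ℕ} (hD : ∀ a, 0 < D a) (hℓ : IsLeafAt T ℓ u) (s : V ↪ α) :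
    treeWeight D s T =
      treeWeight D (eraseVertex ℓ s) (T.induce {ℓ}ᶜ) * (D (s u) : ℝ)⁻¹ := by
  have hfactor : ∀ x : ({ℓ}ᶜ : Set V), (D (s x) : ℝ) ^ (1 - (T.degree x : ℤ)) =
      (D (s x) : ℝ) ^ (1 - ((T.induce {ℓ}ᶜ).degree x : ℤ)) *
        if x = u then (D (s u) : ℝ)⁻¹ else 1 := fun x => by
    rw [hℓ.degree_coe]
    split_ifs with hx
    · rw [← hx, ← zpow_sub_one₀ (Nat.cast_ne_zero.2 (hD _).ne'), Nat.cast_add, Nat.cast_one,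
        sub_add_eq_sub_sub]
    · rw [mul_one, add_zero]
  rw [treeWeight, prod_eq_mul_prod_compl_singleton ℓ, hℓ.degree_eq_one, Nat.cast_one, sub_self,
    zpow_zero, one_mul, Finset.prod_congr rfl fun x _ => hfactor x, Finset.prod_mul_distrib,
    Finset.prod_ite_eq', if_pos (Finset.mem_univ u)]
  rfl

variable [Fintype α]

lemma sum_eraseVertex_le {F : (({ℓ}ᶜ : Set V) ↪ α) → α → ℝ} (hF : ∀ s w, 0 ≤ F s w) :
    ∑ s : V ↪ α, F (eraseVertex ℓ s) (s ℓ) ≤ ∑ s, ∑ w, F s w := by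
  have hinj : Function.Injective fun s : V ↪ α => (eraseVertex ℓ s, s ℓ) := fun s t hst => by
    obtain ⟨herase, hvalue⟩ : eraseVertex ℓ s = eraseVertex ℓ t ∧ s ℓ = t ℓ := Prod.ext_iff.1 hst
    ext v
    by_cases hv : v = ℓ
    · rw [hv, hvalue]
    · exact DFunLike.congr_fun herase (⟨v, hv⟩ : ({ℓ}ᶜ : Set V))
  calc ∑ s : V ↪ α, F (eraseVertex ℓ s) (s ℓ)
      = ∑ q ∈ Finset.univ.image fun s : V ↪ α => (eraseVertex ℓ s, s ℓ), F q.1 q.2 :=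
        (Finset.sum_image (f := fun q : (({ℓ}ᶜ : Set V) ↪ α) × α => F q.1 q.2) hinj.injOn).symm
    _ ≤ ∑ q : (({ℓ}ᶜ : Set V) ↪ α) × α, F q.1 q.2 :=
        Finset.sum_le_sum_of_subset_of_nonneg (Finset.subset_univ _) fun _ _ _ => hF _ _
    _ = ∑ s, ∑ w, F s w := Fintype.sum_prod_type _

lemma IsLeafAt.sum_treeWeight_mul_le {D : α → ℕ} (hD : ∀ a, 0 < D a) (hℓ : IsLeafAt T ℓ u)
    {F : (({ℓ}ᶜ : Set V) ↪ α) → α → ℝ} (hF : ∀ s w, 0 ≤ F s w) :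
    ∑ s : V ↪ α, treeWeight D s T * F (eraseVertex ℓ s) (s ℓ) ≤
      ∑ s, treeWeight D s (T.induce {ℓ}ᶜ) * ((D (s u) : ℝ)⁻¹ * ∑ w, F s w) := by
  simp only [hℓ.treeWeight_eq hD, Finset.mul_sum, ← mul_assoc]
  exact sum_eraseVertex_le
    (F := fun s w => treeWeight D s (T.induce {ℓ}ᶜ) * (D (s u) : ℝ)⁻¹ * F s w)
    fun s w => mul_nonneg (mul_nonneg (treeWeight_nonneg D s _) (by positivity)) (hF s w)

end Trees

lemma containment_nonneg {V : Type*} (H G : SimpleGraph V) : 0 ≤ containment H G := by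
  rw [containment]
  split_ifs
  exacts [zero_le_one, le_rfl]

lemma containment_le_one {V : Type*} (H G : SimpleGraph V) : containment H G ≤ 1 := by
  rw [containment]
  split_ifs
  exacts [le_rfl, zero_le_one]

lemma map_eq_bot_of_subsingleton {V α : Type*} [Subsingleton V] (s : V ↪ α) (T : SimpleGraph V) :
    T.map s = ⊥ := by
  rw [eq_bot_iff, SimpleGraph.map_le_iff_le_comap]
  exact fun a b hab => (hab.ne (Subsingleton.elim a b)).elim

section Rooted

variable {V α : Type*} [Fintype V] [Fintype α] [DecidableEq α] {D : α → ℕ} {G : SimpleGraph α}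

lemma sum_treeWeight_mul_containment_le_of_subsingleton [Subsingleton V] (D : α → ℕ)
    (G : SimpleGraph α) (a : α) (T : SimpleGraph V) (x : V) :
    ∑ s : V ↪ α with s x = a, treeWeight D s T * containment (T.map s) G ≤ D a := by
  have hdegree : T.degree x = 0 := T.degree_eq_zero_of_subsingleton x
  have hcard : (Finset.univ.filter fun s : V ↪ α => s x = a).card ≤ 1 :=
    Finset.card_le_one.2 fun s hs t ht => by
      ext y
      rw [Subsingleton.elim y x, (Finset.mem_filter.1 hs).2, (Finset.mem_filter.1 ht).2]
  calc ∑ s : V ↪ α with s x = a, treeWeight D s T * containment (T.map s) G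
      ≤ ∑ s : V ↪ α with s x = a, (D a : ℝ) := by
        refine Finset.sum_le_sum fun s hs => ?_
        rw [treeWeight, Fintype.prod_subsingleton _ x, (Finset.mem_filter.1 hs).2, hdegree,
          Nat.cast_zero, sub_zero, zpow_one]
        exact mul_le_of_le_one_right (Nat.cast_nonneg _) (containment_le_one _ _)
    _ ≤ D a := by
        rw [Finset.sum_const, nsmul_eq_mul]
        exact mul_le_of_le_one_left (Nat.cast_nonneg _) (by exact_mod_cast hcard)

lemma sum_treeWeight_mul_containment_le (hD : ∀ a, 0 < D a) (hG : ∀ a, G.degree a = D a) (a : α)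
    {T : SimpleGraph V} (hT : T.IsTree) (x : V) :
    ∑ s : V ↪ α with s x = a, treeWeight D s T * containment (T.map s) G ≤ D a := by
  refine rootedTree_induction (motive := fun V _ T x =>
    ∑ s : V ↪ α with s x = a, treeWeight D s T * containment (T.map s) G ≤ D a)
    (fun V _ _ => sum_treeWeight_mul_containment_le_of_subsingleton D G a)
    (fun V _ T ℓ u x hℓ _ ih => ?_) V hT x
  set T' := T.induce {ℓ}ᶜ
  set F : (({ℓ}ᶜ : Set V) ↪ α) → α → ℝ := fun s w =>
    if s x = a then containment (T'.map s) G * G.adjMatrix ℝ (s u) w else 0 with hF_def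
  have hF : ∀ s w, 0 ≤ F s w := fun s w => by
    simp only [hF_def, SimpleGraph.adjMatrix_apply]
    split_ifs <;> simp [containment_nonneg]
  calc ∑ s : V ↪ α with s x = a, treeWeight D s T * containment (T.map s) G
      = ∑ s : V ↪ α, treeWeight D s T * F (eraseVertex ℓ s) (s ℓ) := by
        simp only [Finset.sum_filter, ← mul_ite_zero, hℓ.containment_map, F]
        rfl
    _ ≤ ∑ s, treeWeight D s T' * ((D (s u) : ℝ)⁻¹ * ∑ w, F s w) := hℓ.sum_treeWeight_mul_le hD hF
    _ = ∑ s : ({ℓ}ᶜ : Set V) ↪ α with s x = a, treeWeight D s T' * containment (T'.map s) G := by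
        rw [Finset.sum_filter]
        refine Finset.sum_congr rfl fun s _ => ?_
        have hDu : (D (s u) : ℝ) ≠ 0 := Nat.cast_ne_zero.2 (hD _).ne'
        simp only [hF_def]
        split_ifs
        · rw [← Finset.mul_sum, sum_adjMatrix_eq_degree, hG]
          field_simp
        · simp only [Finset.sum_const_zero, mul_zero]
    _ ≤ D a := ih

end Rooted

lemma IsMaxEntropy.sum_abs_expect_treeWeight_le (hp : IsMaxEntropy D p) (hD : ∀ i, 0 < D i)
    (hn : 2 ≤ n) {η : ℝ} (hη : 0 ≤ η)
    (hP : Real.exp (-η * n * Real.log n) ≤ bernoulliProb p (graphs D))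
    {V : Type*} [Fintype V] {T : SimpleGraph V} (hT : T.IsTree) (u : V) {k : ℕ}
    (hk : Fintype.card V < k) :
    ∑ s : V ↪ Fin n, ∑ w, treeWeight D s T * (D (s u) : ℝ)⁻¹ *
        |𝔼 G ∈ graphs D, containment (T.map s) G * (G.adjMatrix ℝ (s u) w - p (s u) w)| ≤
      (2 * (η + k) + 2) * √(total D * (n * Real.log n)) := by
  have hcard : Fintype.card (V ↪ Fin n) + 1 ≤ n ^ k := by
    have hle : Fintype.card (V ↪ Fin n) ≤ n ^ Fintype.card V := by
      simpa using Fintype.card_le_of_injective (α := V ↪ Fin n) _ DFunLike.coe_injective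
    exact hle.trans_lt (Nat.pow_lt_pow_right hn hk)
  set W : Fin n → (V ↪ Fin n) → SimpleGraph (Fin n) → ℝ := fun v s G =>
    if s u = v then treeWeight D s T * (D v : ℝ)⁻¹ * containment (T.map s) G else 0 with hW_def
  have hW : ∀ v s, ∀ G, 0 ≤ W v s G := fun v s G => by
    simp only [hW_def]
    split_ifs
    exacts [mul_nonneg (mul_nonneg (treeWeight_nonneg _ _ _) (by positivity))
      (containment_nonneg _ _), le_rfl]
  have hsum : ∀ v, ∀ G ∈ graphs D, ∑ s, W v s G ≤ 1 := fun v G hG => by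
    have h := sum_treeWeight_mul_containment_le hD (mem_graphs.1 hG) v hT u
    simp only [hW_def, ← Finset.sum_filter, mul_right_comm _ (D v : ℝ)⁻¹, ← Finset.sum_mul]
    exact (mul_inv_le_iff₀ (by exact_mod_cast hD v)).2 (by rwa [one_mul])
  refine le_of_eq_of_le ?_ (hp.sum_abs_expect_le_sqrt hn hη hP hcard hW hsum)
  rw [eq_comm, Finset.sum_comm]
  refine Finset.sum_congr rfl fun s _ => ?_
  rw [Finset.sum_eq_single (s u) (fun v _ hv => by simp [hW_def, hv.symm])
    fun h => (h (Finset.mem_univ _)).elim]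
  refine Finset.sum_congr rfl fun w _ => ?_
  simp only [hW_def, if_true, mul_assoc _ (containment _ _), ← Finset.mul_expect, abs_mul,
    abs_of_nonneg (treeWeight_nonneg D s T), abs_inv, Nat.abs_cast]

/-- The contribution of the tree `T` to `M` times the discrepancy. -/
def treeDiscrepancy {V : Type*} [Fintype V] (D : Fin n → ℕ) (p : Fin n → Fin n → ℝ)
    (T : SimpleGraph V) : ℝ :=
  ∑ s : V ↪ Fin n, treeWeight D s T *
    |𝔼 G ∈ graphs D, containment (T.map s) G - containmentProb p (T.map s)|

lemma treeDiscrepancy_of_subsingleton {V : Type*} [Fintype V] [Subsingleton V]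
    (hne : (graphs D).Nonempty) (p : Fin n → Fin n → ℝ) (T : SimpleGraph V) :
    treeDiscrepancy D p T = 0 := by
  refine Finset.sum_eq_zero fun s _ => ?_
  have huniform : 𝔼 G ∈ graphs D, containment (⊥ : SimpleGraph (Fin n)) G = 1 := by
    simp only [containment, bot_le, if_true, Finset.expect_const hne]
  have hbernoulli : containmentProb p ⊥ = 1 := by
    rw [containmentProb_eq_prod]
    exact Finset.prod_eq_one fun e _ => if_neg id
  rw [map_eq_bot_of_subsingleton, huniform, hbernoulli, sub_self, abs_zero, mul_zero]

/-- The two random graphs differ first in whether they contain the pruned tree, and then, given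
that it is present, in the edge to the leaf. -/
lemma IsInPolytope.treeDiscrepancy_le_add (hp : IsInPolytope D p) (hD : ∀ i, 0 < D i)
    {V : Type*} [Fintype V] {T : SimpleGraph V} {ℓ : V} {u : ({ℓ}ᶜ : Set V)}
    (hℓ : IsLeafAt T ℓ u) :
    treeDiscrepancy D p T ≤
      ∑ s : ({ℓ}ᶜ : Set V) ↪ Fin n, ∑ w, treeWeight D s (T.induce {ℓ}ᶜ) * (D (s u) : ℝ)⁻¹ *
        |𝔼 G ∈ graphs D, containment ((T.induce {ℓ}ᶜ).map s) G *
          (G.adjMatrix ℝ (s u) w - p (s u) w)| + treeDiscrepancy D p (T.induce {ℓ}ᶜ) := by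
  set T' := T.induce {ℓ}ᶜ
  set A : (({ℓ}ᶜ : Set V) ↪ Fin n) → Fin n → ℝ := fun s w =>
    |𝔼 G ∈ graphs D, containment (T'.map s) G * (G.adjMatrix ℝ (s u) w - p (s u) w)|
  set B : (({ℓ}ᶜ : Set V) ↪ Fin n) → ℝ := fun s =>
    |𝔼 G ∈ graphs D, containment (T'.map s) G - containmentProb p (T'.map s)|
  have hsplit : ∀ s : V ↪ Fin n,
      |𝔼 G ∈ graphs D, containment (T.map s) G - containmentProb p (T.map s)| ≤
        A (eraseVertex ℓ s) (s ℓ) + B (eraseVertex ℓ s) * p (s u) (s ℓ) := fun s => by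
    rw [← abs_of_nonneg (hp.nonneg (s u) (s ℓ)), ← abs_mul]
    refine le_of_eq_of_le (congrArg abs ?_) (abs_add_le _ _)
    simp only [hℓ.containment_map, hℓ.containmentProb_map hp.symm, mul_sub,
      Finset.expect_sub_distrib, ← Finset.expect_mul, sub_mul]
    exact (sub_add_sub_cancel _ _ _).symm
  calc treeDiscrepancy D p T
      ≤ ∑ s : V ↪ Fin n, treeWeight D s T *
          (A (eraseVertex ℓ s) (s ℓ) + B (eraseVertex ℓ s) * p (s u) (s ℓ)) :=
        Finset.sum_le_sum fun s _ =>
          mul_le_mul_of_nonneg_left (hsplit s) (treeWeight_nonneg D s T)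
    _ ≤ ∑ s, treeWeight D s T' * ((D (s u) : ℝ)⁻¹ * ∑ w, (A s w + B s * p (s u) w)) :=
        hℓ.sum_treeWeight_mul_le hD (F := fun s w => A s w + B s * p (s u) w) fun s w =>
          add_nonneg (abs_nonneg _) (mul_nonneg (abs_nonneg _) (hp.nonneg _ _))
    _ = _ := by
        rw [treeDiscrepancy, ← Finset.sum_add_distrib]
        refine Finset.sum_congr rfl fun s _ => ?_
        have hDu : (D (s u) : ℝ) ≠ 0 := Nat.cast_ne_zero.2 (hD _).ne'
        rw [Finset.sum_add_distrib, ← Finset.mul_sum, hp.row_sum, ← Finset.mul_sum]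
        simp only [A, B]
        field_simp

lemma IsMaxEntropy.treeDiscrepancy_le (hp : IsMaxEntropy D p) (hD : ∀ i, 0 < D i)
    (hn : 2 ≤ n) {η : ℝ} (hη : 0 ≤ η)
    (hP : Real.exp (-η * n * Real.log n) ≤ bernoulliProb p (graphs D))
    {V : Type*} [Fintype V] {T : SimpleGraph V} (hT : T.IsTree) {k : ℕ}
    (hk : Fintype.card V ≤ k) :
    treeDiscrepancy D p T ≤
      Fintype.card V * ((2 * (η + k) + 2) * √(total D * (n * Real.log n))) := by
  obtain ⟨x⟩ := hT.connected.nonempty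
  refine rootedTree_induction (motive := fun V _ T _ => Fintype.card V ≤ k →
    treeDiscrepancy D p T ≤
      Fintype.card V * ((2 * (η + k) + 2) * √(total D * (n * Real.log n))))
    (fun V _ _ T _ _ => ?_) (fun V _ T ℓ u _ hℓ hT' ih hk => ?_) V hT x hk
  · rw [treeDiscrepancy_of_subsingleton
      (graphs_nonempty_of_bernoulliProb_pos ((Real.exp_pos _).trans_le hP))]
    positivity
  · have hcard : Fintype.card ({ℓ}ᶜ : Set V) + 1 = Fintype.card V := by
      rw [Fintype.card_compl_set, Set.card_singleton]
      exact Nat.sub_add_cancel (Fintype.card_pos_iff.2 ⟨ℓ⟩)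
    have hedge := hp.sum_abs_expect_treeWeight_le hD hn hη hP hT' u (k := k) (by omega)
    rw [← hcard, Nat.cast_succ, add_one_mul, add_comm]
    exact (hp.1.treeDiscrepancy_le_add hD hℓ).trans (add_le_add hedge (ih (by omega)))

/-! ### The discrepancy -/

lemma discrepancy_eq (k : ℕ) (D : Fin n → ℕ) (p : Fin n → Fin n → ℝ) :
    discrepancy k D p =
      1 / total D * ∑ T : SimpleGraph (Fin k) with T.IsTree, treeDiscrepancy D p T := by
  have hind : ∀ (s : Fin k ↪ Fin n) T G, treeIndicator s T G = containment (T.map s) G :=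
    fun s T G => if_congr (SimpleGraph.map_le_iff_le_comap s T G).symm rfl rfl
  have hweight : ∀ (s : Fin k ↪ Fin n) T, 1 / bFunction D s T = treeWeight D s T := fun s T => by
    simp only [bFunction, treeWeight, one_div, ← Finset.prod_inv_distrib, ← zpow_neg, neg_sub]
  simp only [discrepancy, treeDiscrepancy, treeProbUniform, treeProbBernoulli, hind, hweight,
    containmentProb, Finset.expect_eq_sum_div_card]
  rw [Finset.sum_comm]

lemma IsInPolytope.one_lt_of_pos (hp : IsInPolytope D p) {i : Fin n} (hi : 0 < D i) : 1 < n := by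
  by_contra hn
  have hrow := hp.row_sum i
  rw [Finset.sum_eq_zero fun j _ => by
    rw [show j = i from Fin.ext (by omega), hp.diag]] at hrow
  exact hi.ne (by exact_mod_cast hrow)

lemma IsMaxEntropy.discrepancy_le (hp : IsMaxEntropy D p) (hD : ∀ i, 0 < D i) {η : ℝ}
    (hη : 0 ≤ η) (hP : Real.exp (-η * n * Real.log n) ≤ bernoulliProb p (graphs D)) (k : ℕ) :
    discrepancy k D p ≤ (Finset.univ.filter fun T : SimpleGraph (Fin k) => T.IsTree).card *
      (k * (2 * (η + k) + 2)) * √(n * Real.log n / total D) := by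
  rw [discrepancy_eq]
  rcases n.eq_zero_or_pos with rfl | hn
  · simp [total]
  have hn2 : 2 ≤ n := hp.1.one_lt_of_pos (hD ⟨0, hn⟩)
  have hM : (0 : ℝ) < total D := by
    exact_mod_cast Finset.sum_pos (fun i _ => hD i) ⟨⟨0, hn⟩, Finset.mem_univ _⟩
  have htree : ∀ T ∈ Finset.univ.filter fun T : SimpleGraph (Fin k) => T.IsTree,
      treeDiscrepancy D p T ≤ k * ((2 * (η + k) + 2) * √(total D * (n * Real.log n))) :=
    fun T hT => by
      simpa only [Fintype.card_fin] using
        hp.treeDiscrepancy_le hD hn2 hη hP (Finset.mem_filter.1 hT).2 (Fintype.card_fin k).le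
  have hsqrt : 1 / total D * √(total D * (n * Real.log n)) = √(n * Real.log n / total D) := by
    rw [Real.sqrt_mul hM.le, Real.sqrt_div' _ hM.le, ← mul_assoc, one_div_mul_eq_div,
      Real.sqrt_div_self', one_div_mul_eq_div]
  calc _ ≤ 1 / total D * ((Finset.univ.filter fun T : SimpleGraph (Fin k) => T.IsTree).card •
          (k * ((2 * (η + k) + 2) * √(total D * (n * Real.log n))))) := by
        gcongr
        exact Finset.sum_le_card_nsmul _ _ _ htree
    _ = _ := by
        rw [← hsqrt, nsmul_eq_mul]
        ring

end

end DegSeq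

theorem mainTheorem10_general :
    (∀ (n : ℕ) (D : Fin n → ℕ) (p : Fin n → Fin n → ℝ), DegSeq.IsMaxEntropy D p →
      ∀ G ∈ DegSeq.graphs D,
        0 < DegSeq.bernoulliProb p (DegSeq.graphs D) ∧
        DegSeq.bernoulliMass p G / DegSeq.bernoulliProb p (DegSeq.graphs D) =
          1 / ((DegSeq.graphs D).card : ℝ)) ∧
    (∀ (k : ℕ) (η : ℝ), 0 < η → ∃ c : ℝ, 0 < c ∧
      ∀ (n : ℕ) (D : Fin n → ℕ) (p : Fin n → Fin n → ℝ),
        (∀ i, 0 < D i) → DegSeq.IsMaxEntropy D p →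
          Real.exp (-η * n * Real.log n) ≤ DegSeq.bernoulliProb p (DegSeq.graphs D) →
            DegSeq.discrepancy k D p ≤
              c * Real.sqrt (n * Real.log n / DegSeq.total D)) ∧
    (∀ 𝒟 : (n : ℕ) → Set (Fin n → ℕ), (∀ n, ∀ D ∈ 𝒟 n, ∀ i, 0 < D i) →
      (∃ η : ℝ, 0 < η ∧ ∀ n, ∀ D ∈ 𝒟 n, ∀ p, DegSeq.IsMaxEntropy D p →
        Real.exp (-η * n * Real.log n) * Real.exp (DegSeq.entropy p) ≤
          ((DegSeq.graphs D).card : ℝ)) →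
      ∀ k : ℕ, ∃ c : ℝ, 0 < c ∧ ∀ n, ∀ D ∈ 𝒟 n, ∀ p, DegSeq.IsMaxEntropy D p →
        DegSeq.discrepancy k D p ≤ c * Real.sqrt (n * Real.log n / DegSeq.total D)) := by
  have hbound : ∀ (k : ℕ) (η : ℝ), 0 < η → ∃ c : ℝ, 0 < c ∧
      ∀ (n : ℕ) (D : Fin n → ℕ) (p : Fin n → Fin n → ℝ),
        (∀ i, 0 < D i) → DegSeq.IsMaxEntropy D p →
          Real.exp (-η * n * Real.log n) ≤ DegSeq.bernoulliProb p (DegSeq.graphs D) →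
            DegSeq.discrepancy k D p ≤ c * √(n * Real.log n / DegSeq.total D) :=
    fun k η hη => ⟨_ + 1, by positivity, fun n D p hD hp hP =>
      (hp.discrepancy_le hD hη.le hP k).trans
        (mul_le_mul_of_nonneg_right (le_add_of_nonneg_right zero_le_one) (Real.sqrt_nonneg _))⟩
  refine ⟨fun n D p hp G hG => ⟨hp.bernoulliProb_graphs_pos ⟨G, hG⟩,
    hp.bernoulliMass_div_bernoulliProb hG⟩, hbound, fun 𝒟 hpos ⟨η, hη, hlower⟩ k => ?_⟩
  obtain ⟨c, hc, hle⟩ := hbound k η hη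
  refine ⟨c, hc, fun n D hD p hp => hle n D p (hpos n D hD) hp ?_⟩
  rw [hp.bernoulliProb_graphs, Real.exp_neg, ← div_eq_mul_inv, le_div_iff₀ (Real.exp_pos _)]
  exact hlower n D hD p hp

theorem mainTheorem10 :
    -- conditioned on having degree sequence `D`, the max-entropy graph is uniform
    (∀ (n : ℕ) (D : Fin n → ℕ) (p : Fin n → Fin n → ℝ),
      DegSeq.IsStrictGraphic D → DegSeq.IsMaxEntropy D p →
        ∀ G ∈ DegSeq.graphs D,
          0 < DegSeq.bernoulliProb p (DegSeq.graphs D) ∧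
          DegSeq.bernoulliMass p G / DegSeq.bernoulliProb p (DegSeq.graphs D) =
            1 / ((DegSeq.graphs D).card : ℝ)) ∧
    -- the lower bound for a single `D` gives the discrepancy bound for that `D`
    (∀ (k : ℕ) (η : ℝ), 0 < η → ∃ c : ℝ, 0 < c ∧
      ∀ (ε : ℝ), 0 < ε → ∀ (n : ℕ) (D : Fin n → ℕ) (p : Fin n → Fin n → ℝ),
        DegSeq.IsStrictGraphicOfType ε D → DegSeq.IsMaxEntropy D p →
          Real.exp (-η * n * Real.log n) ≤ DegSeq.bernoulliProb p (DegSeq.graphs D) →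
            DegSeq.discrepancy k D p ≤
              c * Real.sqrt (n * Real.log n / DegSeq.total D)) ∧
    -- the first conjecture implies the second
    (∀ ε : ℝ, 0 < ε → DegSeq.LowerBoundConjecture ε → DegSeq.DiscrepancyConjecture ε) := by
  obtain ⟨huniform, hdiscrepancy, hconjecture⟩ := mainTheorem10_general
  refine ⟨fun n D p _ => huniform n D p, fun k η hη => ?_, fun ε _ ⟨η, hη, hlower⟩ k => ?_⟩
  · obtain ⟨c, hc, hle⟩ := hdiscrepancy k η hη
    exact ⟨c, hc, fun ε _ n D p hD => hle n D p hD.pos⟩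
  · obtain ⟨c, hc, hle⟩ := hconjecture (fun _ => {D | DegSeq.IsStrictGraphicOfType ε D})
      (fun _ _ hD => hD.pos) ⟨η, hη, fun n D hD p hp => (hlower n D p hD hp).1⟩ k
    exact ⟨c, hc, fun n D p hD => hle n D hD p⟩
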